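/- Let $d\ge 1$, $0<c_j<1$ for $j\in D=\{1,\dots,d\}$, and let $\mathbf X_0,\mathbf Y_1,\mathbf Y_2,\dots$ be independent random vectors in $\mathbb R^d$, where the $\mathbf Y_n$, $n\ge1$, have a common law. Define the multivariate ARMAX process by $$X_{n,j}=\max(c_jX_{n-1,j},\,Y_{n,j}),\qquad n\ge 1,\ j\in D,$$ and suppose that $\{\mathbf X_n\}_{n\ge1}$ is stationary; let $F$ be the law of $\mathbf X_1$. All vector inequalities are componentwise. Let $H$ be a probability distribution on $\mathbb R^d$ each of whose margins $H_j$ is a Gumbel distribution $\Lambda(x)=\exp(-e^{-x})$, a Weibull distribution $\Psi_{\alpha_j}(x)=\exp(-(-x)^{\alpha_j})$ for $x\le0$ (and $1$ for $x>0$), or a Fréchet distribution $\Phi_{\alpha_j}(x)=\exp(-x^{-\alpha_j})$ for $x>0$ (and $0$ for $x\le0$), with $\alpha_j>0$. Suppose that $F$ belongs to the max-domain of attraction of $H$: there are $a_{n,j}>0$ and $b_{n,j}\in\mathbb R$ such that $F(a_{n,1}x_1+b_{n,1},\dots,a_{n,d}x_d+b_{n,d})^n\to H(x_1,\dots,x_d)$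 at every continuity point of $H$. Let $I=\{j\in D: H_j=\Phi_{\alpha_j}\}$, let $H_I$ be the marginal distribution of $H$ on the coordinates in $I$, and for a distribution $K$ write $C_K(u)=K(K_1^{-1}(u_1),K_2^{-1}(u_2),\dots)$, $u_j\in[0,1]$, where $K_j^{-1}(u)=\inf\{y\in\mathbb R:K_j(y)\ge u\}\in[-\infty,+\infty]$ and $K$ is extended to arguments in $[-\infty,+\infty]$ in the obvious way (for $I=\emptyset$ put $C_{H_I}=1$). Then $\{\mathbf X_n\}_{n\ge1}$ has the multivariate extremal index $$\theta(\boldsymbol\tau)=1-\frac{\log C_{H_I}\big(e^{-\tau_jc_j^{\alpha_j}},\,j\in I\big)}{\log C_H(e^{-\tau_1},\dots,e^{-\tau_d})},\qquad \boldsymbol\tau\in[0,\infty)^d\setminus\{0\}.$$ This means that $\theta(\boldsymbol\tau)\in[0,1]$ and that for every such $\boldsymbol\tau$ there are levels $\mathbf u_n\in\mathbb R^d$ and a number $\gamma\in(0,1)$ such that, as $n\to\infty$, $nP(X_{1,j}>u_{n,j})\to\tau_j$ for every $j\in D$, $P(\mathbf X_1\le\mathbf u_n)^n\to\gamma$, and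 $P(\mathbf X_1\le\mathbf u_n,\dots,\mathbf X_n\le\mathbf u_n)\to\gamma^{\theta(\boldsymbol\tau)}$. Moreover, for each $j\in D$ the sequence $\{X_{n,j}\}_{n\ge1}$ has extremal index $\theta_j=1$ if $H_j$ is $\Lambda$ or $\Psi_{\alpha_j}$, and $\theta_j=1-c_j^{\alpha_j}$ if $H_j=\Phi_{\alpha_j}$. This means that $\theta_j\in[0,1]$ and that for every $\tau>0$ there are levels $u_n\in\mathbb R$ with $nP(X_{1,j}>u_n)\to\tau$ and $P(\max(X_{1,j},\dots,X_{n,j})\le u_n)\to e^{-\theta_j\tau}$. -/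

import Mathlib

open MeasureTheory ProbabilityTheory Filter
open scoped Topology

noncomputable section

namespace MaxArmax

/-! ### Distribution functions and copulas -/

/-- The joint distribution function `F(x) = μ{y : y_i ≤ x_i for all i}` of a law `μ` on `ℝ^ι`. -/
def jointCdf {ι : Type*} (μ : Measure (ι → ℝ)) (x : ι → ℝ) : ℝ :=
  μ.real (Set.Iic x)

/-- The joint distribution function with arguments in `[-∞, +∞]^ι`. -/
def jointCdfExt {ι : Type*} (μ : Measure (ι → ℝ)) (x : ι → EReal) : ℝ :=
  μ.real {y | ∀ i, (y i : EReal) ≤ x i}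

/-- The `j`-th one-dimensional margin of a law on `ℝ^ι`. -/
def margin {ι : Type*} (μ : Measure (ι → ℝ)) (j : ι) : Measure ℝ :=
  μ.map (fun x => x j)

/-- The margin of a law on `ℝ^ι` for the set `I` of indices. -/
def marginOn {ι : Type*} (μ : Measure (ι → ℝ)) (I : Set ι) : Measure (I → ℝ) :=
  μ.map (fun x (i : I) => x i)

/-- The generalized inverse `F⁻¹(u) = inf {y ∈ ℝ : F(y) ≥ u}` of the distribution function of a
law on `ℝ`, as an extended real number (`inf ∅ = +∞`). -/
def genInverse (μ : Measure ℝ) (u : ℝ) : EReal :=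
  sInf ((fun y : ℝ => (y : EReal)) '' {y : ℝ | u ≤ cdf μ y})

/-- The copula function `C_F(u) = F(F₁⁻¹(u₁), …, F_d⁻¹(u_d))` of a law on `ℝ^ι`. -/
def copula {ι : Type*} (μ : Measure (ι → ℝ)) (u : ι → ℝ) : ℝ :=
  jointCdfExt μ (fun i => genInverse (margin μ i) (u i))

/-! ### Extreme value distributions and max-domains of attraction -/

/-- The Gumbel distribution function `Λ`. -/
def gumbelCdf (x : ℝ) : ℝ := Real.exp (-Real.exp (-x))

/-- The Weibull extreme value distribution function `Ψ_α`. -/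
def weibullCdf (α x : ℝ) : ℝ := if x ≤ 0 then Real.exp (-(-x) ^ α) else 1

/-- The Fréchet distribution function `Φ_α`. -/
def frechetCdf (α x : ℝ) : ℝ := if 0 < x then Real.exp (-x ^ (-α)) else 0

/-- `F ∈ 𝓓(H)`: for suitable constants `a_{n,j} > 0` and `b_{n,j}`, the normalized componentwise
maxima of `n` independent vectors with law `F` converge in distribution to `H`, that is
`F(a_{n,1} x₁ + b_{n,1}, …, a_{n,d} x_d + b_{n,d})^n → H(x)` at the continuity points `x` of `H`. -/
def InMaxDomain {ι : Type*} (F H : Measure (ι → ℝ)) : Prop :=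
  ∃ a b : ℕ → ι → ℝ, (∀ n j, 0 < a n j) ∧
    ∀ x : ι → ℝ, ContinuousAt (jointCdf H) x →
      Tendsto (fun n : ℕ => jointCdf F (fun j => a n j * x j + b n j) ^ n) atTop
        (𝓝 (jointCdf H x))

/-- The set of indices `j` for which the margin `H_j` is the Fréchet distribution `Φ_{α_j}`. -/
def frechetIndices {ι : Type*} (H : Measure (ι → ℝ)) (α : ι → ℝ) : Set ι :=
  {j | (cdf (margin H j) : ℝ → ℝ) = frechetCdf (α j)}

/-! ### Multivariate ARMAX processes -/

/-- `(X_n)_{n ≥ 1}` is the multivariate ARMAX process with parameters `c_j ∈ (0, 1)`, initial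
vector `X₀`, and innovations `Y₁, Y₂, …` with law `G`: the vectors `X₀, Y₁, Y₂, …` are independent
and `X_{n,j} = c_j X_{n-1,j} ∨ Y_{n,j}` for `n ≥ 1`. The vector `Y 0` plays no role. -/
structure IsArmax {d : ℕ} {Ω : Type*} [MeasurableSpace Ω] (P : Measure Ω) (c : Fin d → ℝ)
    (G : Measure (Fin d → ℝ)) (X Y : ℕ → Ω → Fin d → ℝ) : Prop where
  pos : ∀ j, 0 < c j
  lt_one : ∀ j, c j < 1
  measurable_init : Measurable (X 0)
  measurable_innov : ∀ n, 1 ≤ n → Measurable (Y n)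
  indep : iIndepFun (fun n : ℕ => if n = 0 then X 0 else Y n) P
  law_innov : ∀ n, 1 ≤ n → P.map (Y n) = G
  recursion : ∀ n, 1 ≤ n → ∀ ω j, X n ω j = max (c j * X (n - 1) ω j) (Y n ω j)

/-- The sequence `X₁, X₂, …` is (strictly) stationary: its law is invariant under time shifts. -/
def IsStationary {E Ω : Type*} [MeasurableSpace E] [MeasurableSpace Ω] (P : Measure Ω)
    (X : ℕ → Ω → E) : Prop :=
  ∀ k : ℕ, P.map (fun ω (n : ℕ) => X (n + 1 + k) ω) = P.map (fun ω (n : ℕ) => X (n + 1) ω)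

/-! ### Extremal indices -/

/-- The stationary real sequence `X₁, X₂, …` has extremal index `θ ∈ [0, 1]`: for every `τ > 0`
there are levels `u_n` with `n P(X₁ > u_n) → τ` and
`P(max(X₁, …, X_n) ≤ u_n) → e^{-θ τ}`. -/
def HasExtremalIndex {Ω : Type*} [MeasurableSpace Ω] (P : Measure Ω) (X : ℕ → Ω → ℝ)
    (θ : ℝ) : Prop :=
  0 ≤ θ ∧ θ ≤ 1 ∧ ∀ τ : ℝ, 0 < τ → ∃ u : ℕ → ℝ,
    Tendsto (fun n : ℕ => (n : ℝ) * P.real {ω | u n < X 1 ω}) atTop (𝓝 τ) ∧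
    Tendsto (fun n : ℕ => P.real {ω | ∀ i ∈ Finset.Icc 1 n, X i ω ≤ u n}) atTop
      (𝓝 (Real.exp (-(θ * τ))))

/-- The stationary sequence of random vectors `X₁, X₂, …` has multivariate extremal index
`θ(τ) ∈ [0, 1]`: for every `τ ∈ [0, ∞)^ι`, `τ ≠ 0`, there are levels `u_n = (u_{n,j})_j` with
`n P(X_{1,j} > u_{n,j}) → τ_j` for each `j`, such that, as `n → ∞`, the componentwise maximum of
`n` independent copies of `X₁` satisfies `P(M̂_n ≤ u_n) = P(X₁ ≤ u_n)^n → γ`, and the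
componentwise maximum `M_n` of `X₁, …, X_n` satisfies `P(M_n ≤ u_n) → γ ^ θ(τ)`, with
`0 < γ < 1`. -/
def HasMultivariateExtremalIndex {ι Ω : Type*} [MeasurableSpace Ω] (P : Measure Ω)
    (X : ℕ → Ω → ι → ℝ) (θ : (ι → ℝ) → ℝ) : Prop :=
  ∀ τ : ι → ℝ, (∀ j, 0 ≤ τ j) → τ ≠ 0 →
    0 ≤ θ τ ∧ θ τ ≤ 1 ∧ ∃ (u : ℕ → ι → ℝ) (γ : ℝ), 0 < γ ∧ γ < 1 ∧
      (∀ j, Tendsto (fun n : ℕ => (n : ℝ) * P.real {ω | u n j < X 1 ω j}) atTop (𝓝 (τ j))) ∧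
      Tendsto (fun n : ℕ => P.real {ω | ∀ j, X 1 ω j ≤ u n j} ^ n) atTop (𝓝 γ) ∧
      Tendsto (fun n : ℕ => P.real {ω | ∀ i ∈ Finset.Icc 1 n, ∀ j, X i ω j ≤ u n j}) atTop
        (𝓝 (γ ^ θ τ))

end MaxArmax

end

/-!
Write `F` for the law of `X₁` and `x / c` for the componentwise quotient. The recursion and
stationarity give `F(x) = F(x / c) G(x)` (`IsArmax.prob_eq_mul`). Iterating this in one coordinate
at `x < 0` shows that the margins of `F` live on `[0, ∞)`. For levels `u ≥ 0` the event
`M_n ≤ u` only constrains `X₀` and the innovations (`IsArmax.prob_forall_mem`), whence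
`P(M_n ≤ u) F(u / c)^n = F(u)^n F(u / c)`. So everything reduces to the two limits of `F(u_n)^n` and
`F(u_n / c)^n`: if they are `γ` and `δ`, then `P(M_n ≤ u_n) → γ / δ = γ^(1 - log δ / log γ)`.

The limits come from `tendsto_jointCdf_pow`: if `n (1 - F_j(u_{n,j})) → t_j` for all `j`, then
`F(u_n)^n → C_H(e^{-t_1}, …, e^{-t_d})`. It holds because a joint distribution function is
`ℓ¹`-Lipschitz in its margins, so that arbitrary levels may be compared with
`a_{n,j} x_j + b_{n,j}`.

It remains to find, for each coordinate, levels with `n (1 - F_j(u_n)) → τ` and to compute the limit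
of `n (1 - F_j(u_n / c))` (`HasScaledLevels`). As `F_j` lives on `[0, ∞)`, a limit law that charges
every neighbourhood of `-∞`, as `Λ` and `Ψ_α` do, forces `b_n / a_n → ∞`, and then `u_n / c` exceeds
`a_n y + b_n` for every `y`: the limit is `0` (`hasScaledLevels_zero`). In the Fréchet case
`b_n / a_n → 0`, by comparing the normalizing constants at `n` and `⌊n/2⌋`
(`eventually_div_le_of_frechet`), and the limit is `τ c^α` (`hasScaledLevels_frechet`). Coordinates
with limit `0` drop out of the copula (`copula_marginOn_eq`), which leaves `C_{H_I}`.
-/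

namespace MaxArmax

/-! ### Powers and tails -/

theorem tendsto_pow_of_tendsto_mul_one_sub {p : ℕ → ℝ} {t : ℝ}
    (h : Tendsto (fun n : ℕ => (n : ℝ) * (1 - p n)) atTop (𝓝 t)) :
    Tendsto (fun n : ℕ => p n ^ n) atTop (𝓝 (Real.exp (-t))) := by
  have h1 : Tendsto (fun n : ℕ => (n : ℝ) * (p n - 1)) atTop (𝓝 (-t)) := by
    refine h.neg.congr fun n => ?_
    ring
  refine (Real.tendsto_one_add_pow_exp_of_tendsto h1).congr fun n => ?_
  simp

theorem tendsto_one_of_tendsto_mul_one_sub {p : ℕ → ℝ} {t : ℝ}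
    (h : Tendsto (fun n : ℕ => (n : ℝ) * (1 - p n)) atTop (𝓝 t)) :
    Tendsto p atTop (𝓝 1) := by
  have h1 := (h.mul tendsto_one_div_atTop_nhds_zero_nat).const_sub 1
  rw [mul_zero, sub_zero] at h1
  refine h1.congr' ?_
  filter_upwards [eventually_gt_atTop 0] with n hn
  have : (n : ℝ) ≠ 0 := by positivity
  field_simp
  ring

theorem tendsto_mul_one_sub_of_tendsto_pow {p : ℕ → ℝ} {t : ℝ} (h0 : ∀ n, 0 ≤ p n)
    (h : Tendsto (fun n : ℕ => p n ^ n) atTop (𝓝 (Real.exp (-t)))) :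
    Tendsto (fun n : ℕ => (n : ℝ) * (1 - p n)) atTop (𝓝 t) := by
  have hpos : ∀ᶠ n in atTop, 0 < p n := by
    filter_upwards [h.eventually_const_lt (Real.exp_pos _), eventually_gt_atTop 0] with n hn hn0
    refine (h0 n).lt_of_ne fun he => ?_
    rw [← he, zero_pow hn0.ne'] at hn
    exact hn.false
  have hlog : Tendsto (fun n : ℕ => -((n : ℝ) * Real.log (p n))) atTop (𝓝 t) := by
    have h1 := (h.log (Real.exp_pos _).ne').neg
    rw [Real.log_exp, neg_neg] at h1
    simpa only [Real.log_pow] using h1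
  have hlog0 : Tendsto (fun n : ℕ => Real.log (p n)) atTop (𝓝 0) := by
    have h1 := (hlog.mul tendsto_one_div_atTop_nhds_zero_nat).neg
    rw [mul_zero, neg_zero] at h1
    refine h1.congr' ?_
    filter_upwards [eventually_gt_atTop 0] with n hn
    have : (n : ℝ) ≠ 0 := by positivity
    field_simp
  have hp1 : Tendsto p atTop (𝓝 1) := by
    have h1 := hlog0.rexp
    rw [Real.exp_zero] at h1
    refine h1.congr' ?_
    filter_upwards [hpos] with n hn using Real.exp_log hn
  -- `p (-log p) ≤ 1 - p ≤ -log p`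
  refine tendsto_of_tendsto_of_tendsto_of_le_of_le' (by simpa using hp1.mul hlog) hlog ?_ ?_
  · filter_upwards [hpos] with n hn
    have h1 := Real.log_le_sub_one_of_pos (inv_pos.2 hn)
    rw [Real.log_inv] at h1
    have h2 : p n * (-Real.log (p n)) ≤ 1 - p n := by
      calc p n * (-Real.log (p n)) ≤ p n * ((p n)⁻¹ - 1) := by gcongr
        _ = 1 - p n := by field_simp
    nlinarith [mul_le_mul_of_nonneg_left h2 (Nat.cast_nonneg (α := ℝ) n)]
  · filter_upwards [hpos] with n hn
    have h1 := Real.log_le_sub_one_of_pos hn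
    nlinarith [mul_le_mul_of_nonneg_left h1 (Nat.cast_nonneg (α := ℝ) n)]

theorem abs_pow_sub_pow_le_mul {p q : ℝ} (hp : 0 ≤ p) (hp1 : p ≤ 1) (hq : 0 ≤ q) (hq1 : q ≤ 1)
    (n : ℕ) : |p ^ n - q ^ n| ≤ n * |p - q| := by
  refine (abs_pow_sub_pow_le p q n).trans ?_
  have h1 : max |p| |q| ^ (n - 1) ≤ 1 := by
    rw [abs_of_nonneg hp, abs_of_nonneg hq]
    exact pow_le_one₀ (le_max_of_le_left hp) (max_le hp1 hq1)
  calc |p - q| * n * max |p| |q| ^ (n - 1) ≤ |p - q| * n * 1 := by gcongr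
    _ = n * |p - q| := by ring

/-- With `p = P(A ∩ B)`, `q = P(A)` and `s = P(B)`, this is the bound `P(A) ≤ P(A ∩ B) + P(Bᶜ)`
for the events that all of `n` independent trials fall into `A`, respectively into `B`. -/
theorem pow_le_pow_add_one_sub_pow {p q s : ℝ} (hp : 0 ≤ p) (hpq : p ≤ q) (hps : p ≤ s)
    (hq : q ≤ 1) (hs : s ≤ 1) (h : q ≤ p + (1 - s)) (n : ℕ) : q ^ n ≤ p ^ n + (1 - s ^ n) := by
  induction n with
  | zero => simp
  | succ n ih =>
    have h1 : p ^ n ≤ s ^ n := by gcongr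
    have h2 : s ^ n ≤ 1 := pow_le_one₀ (hp.trans hps) hs
    have h3 : 0 ≤ p ^ n := by positivity
    calc q ^ (n + 1) = q ^ n * q := pow_succ _ _
      _ ≤ (p ^ n + (1 - s ^ n)) * q := by gcongr; exact hp.trans hpq
      _ ≤ p ^ (n + 1) + (1 - s ^ (n + 1)) := by
        rw [pow_succ, pow_succ]
        nlinarith [mul_nonneg (sub_nonneg.2 h) h3, mul_nonneg (sub_nonneg.2 hq) (sub_nonneg.2 h2),
          mul_nonneg (sub_nonneg.2 hs) (sub_nonneg.2 h1)]

/-! ### Normalizing constants in the Fréchet domain of attraction -/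

/-- A sequence contracted by `n ↦ ⌊n/2⌋` up to arbitrarily small errors is asymptotically
nonpositive. -/
theorem eventually_le_of_le_half {r : ℕ → ℝ} {l : ℝ} (hl0 : 0 ≤ l) (hl : l < 1)
    (h : ∀ δ > 0, ∀ᶠ n in atTop, r n ≤ l * max (r (n / 2)) 0 + δ) {ε : ℝ} (hε : 0 < ε) :
    ∀ᶠ n in atTop, r n ≤ ε := by
  -- with error `(1 - l) e`, the excess over `e` is multiplied by `l` from `⌊n/2⌋` to `n`
  set e : ℝ := ε / 2 with he
  have he0 : 0 < e := by positivity
  obtain ⟨N, hN⟩ := eventually_atTop.1 (h ((1 - l) * e) (mul_pos (by linarith) he0))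
  have step : ∀ n ≥ N, ∀ K : ℝ, 0 ≤ K → r (n / 2) ≤ e + K → r n ≤ e + l * K := by
    intro n hn K hK hr
    have h1 : max (r (n / 2)) 0 ≤ e + K := max_le hr (by positivity)
    have h2 := mul_le_mul_of_nonneg_left h1 hl0
    linarith [hN n hn]
  set C : ℝ := ∑ i ∈ Finset.range (N + 1), |r i| with hC
  have hC0 : 0 ≤ C := Finset.sum_nonneg fun _ _ => abs_nonneg _
  have base : ∀ n, r n ≤ e + C := by
    intro n
    induction n using Nat.strong_induction_on with
    | _ n ih =>
      by_cases hn : n < N + 1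
      · have : |r n| ≤ C := Finset.single_le_sum (f := fun i => |r i|)
          (fun _ _ => abs_nonneg _) (Finset.mem_range.2 hn)
        linarith [le_abs_self (r n)]
      · have := step n (by omega) C hC0 (ih _ (by omega))
        nlinarith
  have iter : ∀ k : ℕ, ∀ n ≥ (N + 1) * 2 ^ k, r n ≤ e + l ^ k * C := by
    intro k
    induction k with
    | zero => intro n _; simpa using base n
    | succ k ih =>
      intro n hn
      rw [pow_succ] at hn
      have h1 : 1 ≤ 2 ^ k := Nat.one_le_two_pow
      have h2 : (N + 1) * 2 ^ k ≤ n / 2 := by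
        rw [Nat.le_div_iff_mul_le two_pos]; linarith
      have := step n (by nlinarith) _ (by positivity) (ih _ h2)
      calc r n ≤ e + l * (l ^ k * C) := this
        _ = e + l ^ (k + 1) * C := by ring
  have hlim : Tendsto (fun k : ℕ => l ^ k * C) atTop (𝓝 0) := by
    simpa using (tendsto_pow_atTop_nhds_zero_of_lt_one hl0 hl).mul_const C
  obtain ⟨k, hk⟩ := (hlim.eventually_lt_const he0).exists
  filter_upwards [eventually_ge_atTop ((N + 1) * 2 ^ k)] with n hn
  linarith [iter k n hn]

/-- Passing from `n` to `⌊n/2⌋` in the normalizing constants doubles the limit of the tails. -/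
theorem tendsto_mul_half {g : ℕ → ℝ} {t : ℝ}
    (h : Tendsto (fun n : ℕ => (n : ℝ) * g n) atTop (𝓝 t)) :
    Tendsto (fun n : ℕ => (n : ℝ) * g (n / 2)) atTop (𝓝 (2 * t)) := by
  have hhalf : Tendsto (fun n : ℕ => n / 2) atTop atTop :=
    Nat.tendsto_div_const_atTop two_ne_zero
  have h0 : Tendsto g atTop (𝓝 0) := by
    have h1 := h.mul tendsto_one_div_atTop_nhds_zero_nat
    rw [mul_zero] at h1
    refine h1.congr' ?_
    filter_upwards [eventually_gt_atTop 0] with n hn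
    have : (n : ℝ) ≠ 0 := by positivity
    field_simp
  have herr : Tendsto (fun n : ℕ => ((n % 2 : ℕ) : ℝ) * g (n / 2)) atTop (𝓝 0) := by
    refine squeeze_zero_norm (a := fun n => |g (n / 2)|) (fun n => ?_)
      (by simpa using (h0.comp hhalf).abs)
    rw [Real.norm_eq_abs, abs_mul, Nat.abs_cast]
    have : ((n % 2 : ℕ) : ℝ) ≤ 1 := by exact_mod_cast Nat.le_of_lt_succ (Nat.mod_lt n two_pos)
    exact mul_le_of_le_one_left (abs_nonneg _) this
  have h2 := ((h.comp hhalf).const_mul 2).add herr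
  rw [add_zero] at h2
  refine h2.congr fun n => ?_
  have h3 : (n : ℝ) = 2 * ((n / 2 : ℕ) : ℝ) + ((n % 2 : ℕ) : ℝ) := by
    exact_mod_cast (Nat.div_add_mod n 2).symm
  simp only [Function.comp_apply]
  linear_combination -g (n / 2) * h3

/-- Levels with larger limiting tails are eventually smaller. -/
theorem eventually_lt_of_tail_lt {f : ℝ → ℝ} (hf : Monotone f) {s t : ℕ → ℝ} {σ τ : ℝ}
    (hs : Tendsto (fun n : ℕ => (n : ℝ) * (1 - f (s n))) atTop (𝓝 σ))
    (ht : Tendsto (fun n : ℕ => (n : ℝ) * (1 - f (t n))) atTop (𝓝 τ)) (h : σ < τ) :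
    ∀ᶠ n in atTop, t n < s n := by
  filter_upwards [hs.eventually_lt ht h] with n hn
  by_contra! hle
  have := mul_le_mul_of_nonneg_left (hf hle) (Nat.cast_nonneg (α := ℝ) n)
  linarith

/-- In the Fréchet domain the normalizing constants at `n` and `⌊n/2⌋` are related by
`a_{⌊n/2⌋} ≈ 2^{-1/α} a_n` and `b_{⌊n/2⌋} ≈ b_n` (up to `o(a_n)`), so that `b_n / a_n` has no
positive limit point. -/
theorem eventually_div_le_of_frechet {f : ℝ → ℝ} (hf : Monotone f) {a b : ℕ → ℝ}
    (ha : ∀ n, 0 < a n) {α : ℝ} (hα : 0 < α)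
    (h : ∀ x > 0, Tendsto (fun n : ℕ => (n : ℝ) * (1 - f (a n * x + b n))) atTop
      (𝓝 (x ^ (-α)))) {ε : ℝ} (hε : 0 < ε) :
    ∀ᶠ n in atTop, b n / a n ≤ ε := by
  set l : ℝ := 2 ^ (-1 / α) with hl
  have hl0 : 0 < l := by positivity
  have hl1 : l < 1 := Real.rpow_lt_one_of_one_lt_of_neg one_lt_two (by
    rw [neg_div]; exact neg_neg_of_pos (by positivity))
  have hlα : ∀ x > 0, (l * x) ^ (-α) = 2 * x ^ (-α) := by
    intro x hx
    rw [Real.mul_rpow hl0.le hx.le, hl, ← Real.rpow_mul two_pos.le]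
    congr 1
    rw [show -1 / α * -α = 1 by field_simp, Real.rpow_one]
  have up : ∀ x > 0, ∀ δ > 0, ∀ᶠ n in atTop,
      a (n / 2) * x + b (n / 2) < a n * (l * x + δ) + b n := by
    intro x hx δ hδ
    refine eventually_lt_of_tail_lt hf (h (l * x + δ) (by positivity)) (tendsto_mul_half (h x hx)) ?_
    rw [← hlα x hx]
    exact Real.rpow_lt_rpow_of_neg (by positivity) (by linarith) (by linarith)
  have low : ∀ x > 0, ∀ δ > 0, δ < l * x → ∀ᶠ n in atTop,
      a n * (l * x - δ) + b n < a (n / 2) * x + b (n / 2) := by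
    intro x hx δ hδ hδx
    refine eventually_lt_of_tail_lt hf (tendsto_mul_half (h x hx)) (h (l * x - δ) (by linarith)) ?_
    rw [← hlα x hx]
    exact Real.rpow_lt_rpow_of_neg (by linarith) (by linarith) (by linarith)
  refine eventually_le_of_le_half (l := (l + 1) / 2) (by linarith) (by linarith) (fun δ hδ => ?_) hε
  -- a small `η` absorbs the errors at the two points `1` and `2`
  set η : ℝ := min (min (δ / 3) (l / 2)) ((1 - l) / 4) with hη
  have hη0 : 0 < η := by
    refine lt_min (lt_min ?_ ?_) ?_ <;> linarith
  have hη1 : η ≤ δ / 3 := (min_le_left _ _).trans (min_le_left _ _)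
  have hη2 : η ≤ l / 2 := (min_le_left _ _).trans (min_le_right _ _)
  have hη3 : η ≤ (1 - l) / 4 := min_le_right _ _
  filter_upwards [up 2 two_pos η hη0, low 1 one_pos η hη0 (by linarith)] with n h2 h1
  have ha1 := ha n
  have ha2 := ha (n / 2)
  have hA : a (n / 2) ≤ a n * (l + 2 * η) := by nlinarith
  have hB : b n ≤ b (n / 2) + 3 * η * a n := by nlinarith
  rw [div_le_iff₀ ha1]
  have hm : b (n / 2) ≤ max (b (n / 2) / a (n / 2)) 0 * a (n / 2) := by
    calc b (n / 2) = b (n / 2) / a (n / 2) * a (n / 2) := by field_simp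
      _ ≤ _ := by gcongr; exact le_max_left _ _
  have hm0 : 0 ≤ max (b (n / 2) / a (n / 2)) 0 := le_max_right _ _
  have hA' : a (n / 2) ≤ a n * ((l + 1) / 2) := by nlinarith
  have hm1 := mul_le_mul_of_nonneg_left hA' hm0
  nlinarith

/-! ### Levels for one coordinate -/

/-- If `f` vanishes on `(-∞, 0)`, levels `a_n x + b_n` with a positive limit of `f(·)^n` are
eventually nonnegative. -/
theorem eventually_nonneg_of_tendsto_pow {f : ℝ → ℝ} (hneg : ∀ x < 0, f x = 0) {u : ℕ → ℝ} {q : ℝ}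
    (hq : 0 < q) (h : Tendsto (fun n : ℕ => f (u n) ^ n) atTop (𝓝 q)) :
    ∀ᶠ n in atTop, 0 ≤ u n := by
  filter_upwards [h.eventually_const_lt hq, eventually_gt_atTop 0] with n hn hn0
  by_contra! hlt
  rw [hneg _ hlt, zero_pow hn0.ne'] at hn
  exact hn.false

/-- Levels `u` with limiting tail `τ` such that the levels `u / c` have limiting tail `τ * κ`. -/
def HasScaledLevels (f : ℝ → ℝ) (c κ : ℝ) : Prop :=
  ∀ τ : ℝ, 0 ≤ τ → ∃ u : ℕ → ℝ, (∀ᶠ n in atTop, 0 ≤ u n) ∧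
    Tendsto (fun n : ℕ => (n : ℝ) * (1 - f (u n))) atTop (𝓝 τ) ∧
    Tendsto (fun n : ℕ => (n : ℝ) * (1 - f (u n / c))) atTop (𝓝 (τ * κ))

/-- The level `+∞` is approximated by levels with `n (1 - f(u_n)) → 0`. -/
theorem exists_levels_zero {f : ℝ → ℝ} (hf : Monotone f) (h1 : ∀ x, f x ≤ 1)
    (htop : Tendsto f atTop (𝓝 1)) {c : ℝ} (hc0 : 0 < c) (hc1 : c < 1) :
    ∃ u : ℕ → ℝ, (∀ᶠ n in atTop, 0 ≤ u n) ∧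
      Tendsto (fun n : ℕ => (n : ℝ) * (1 - f (u n))) atTop (𝓝 0) ∧
      Tendsto (fun n : ℕ => (n : ℝ) * (1 - f (u n / c))) atTop (𝓝 0) := by
  have hex : ∀ n : ℕ, ∃ x, 0 ≤ x ∧ (n : ℝ) * (1 - f x) ≤ 1 / n := by
    intro n
    rcases Nat.eq_zero_or_pos n with rfl | hn
    · exact ⟨0, le_rfl, by simp⟩
    have hn' : (0 : ℝ) < n := by exact_mod_cast hn
    have h2 : Tendsto (fun x => (n : ℝ) * (1 - f x)) atTop (𝓝 0) := by
      simpa using (htop.const_sub 1).const_mul (n : ℝ)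
    obtain ⟨x, hx1, hx2⟩ := ((h2.eventually_lt_const (show (0 : ℝ) < 1 / n by positivity)).and
      (eventually_ge_atTop 0)).exists
    exact ⟨x, hx2, hx1.le⟩
  choose u hu0 hu using hex
  have hn0 : ∀ x (n : ℕ), 0 ≤ (n : ℝ) * (1 - f x) := fun x n =>
    mul_nonneg n.cast_nonneg (sub_nonneg.2 (h1 x))
  refine ⟨u, Eventually.of_forall hu0, ?_, ?_⟩
  · exact squeeze_zero (fun n => hn0 _ n) hu tendsto_one_div_atTop_nhds_zero_nat
  · refine squeeze_zero (fun n => hn0 _ n) (fun n => le_trans ?_ (hu n))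
      tendsto_one_div_atTop_nhds_zero_nat
    have : f (u n) ≤ f (u n / c) := hf (by rw [le_div_iff₀ hc0]; nlinarith [hu0 n])
    gcongr

/-- Suppose that the limit `h` is positive everywhere, as are `Λ` and `Ψ_α`, and that `f` vanishes
on `(-∞, 0)`. Then `a_n z + b_n` is eventually nonnegative for every real `z`, which means
`b_n / a_n → ∞`, and exceedances of the levels divided by `c < 1` are negligible. -/
theorem hasScaledLevels_zero {f h : ℝ → ℝ} (hf : Monotone f) (h0 : ∀ x, 0 ≤ f x)
    (h1 : ∀ x, f x ≤ 1) (htop : Tendsto f atTop (𝓝 1)) (hneg : ∀ x < 0, f x = 0) {a b : ℕ → ℝ}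
    (hconv : ∀ x, Tendsto (fun n : ℕ => f (a n * x + b n) ^ n) atTop (𝓝 (h x)))
    (hpos : ∀ x, 0 < h x) (hsurj : ∀ t > 0, ∃ x, h x = Real.exp (-t)) {c : ℝ} (hc0 : 0 < c)
    (hc1 : c < 1) : HasScaledLevels f c 0 := by
  intro τ hτ
  rw [mul_zero]
  rcases hτ.eq_or_lt with rfl | hτ
  · exact exists_levels_zero hf h1 htop hc0 hc1
  have tail : ∀ t x, h x = Real.exp (-t) →
      Tendsto (fun n : ℕ => (n : ℝ) * (1 - f (a n * x + b n))) atTop (𝓝 t) := fun t x hx =>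
    tendsto_mul_one_sub_of_tendsto_pow (fun n => h0 _) (hx ▸ hconv x)
  obtain ⟨x, hx⟩ := hsurj τ hτ
  refine ⟨fun n => a n * x + b n, eventually_nonneg_of_tendsto_pow hneg (hpos x) (hconv x),
    tail τ x hx, ?_⟩
  refine Metric.tendsto_nhds.2 fun ε hε => ?_
  obtain ⟨y, hy⟩ := hsurj (ε / 2) (by positivity)
  -- `a_n z + b_n ≥ 0` at this `z` is `(a_n x + b_n) / c ≥ a_n y + b_n`
  set z : ℝ := (x / c - y) / (1 / c - 1) with hz
  have hc : 0 < 1 / c - 1 := by rw [sub_pos, lt_div_iff₀ hc0]; linarith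
  filter_upwards [eventually_nonneg_of_tendsto_pow hneg (hpos z) (hconv z),
    (tail _ y hy).eventually_lt_const (show ε / 2 < ε by linarith)] with n hn hn2
  have hle : a n * y + b n ≤ (a n * x + b n) / c := by
    have h3 := mul_nonneg hn hc.le
    have h4 : (a n * z + b n) * (1 / c - 1) = (a n * x + b n) / c - (a n * y + b n) := by
      rw [add_mul, mul_assoc, hz, div_mul_cancel₀ _ hc.ne']
      ring
    linarith
  rw [Real.dist_eq, sub_zero, abs_of_nonneg (mul_nonneg n.cast_nonneg (sub_nonneg.2 (h1 _)))]
  refine lt_of_le_of_lt ?_ hn2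
  have := hf hle
  gcongr

/-- For the limit `Φ_α`, support in `[0, ∞)` forces `b_n / a_n → 0`. Hence the levels
`u_n = a_n x + b_n` satisfy `u_n / c ≈ a_n (x / c) + b_n`, and `Φ_α` scales the tail by `c^α`. -/
theorem hasScaledLevels_frechet {f : ℝ → ℝ} (hf : Monotone f) (h0 : ∀ x, 0 ≤ f x)
    (h1 : ∀ x, f x ≤ 1) (htop : Tendsto f atTop (𝓝 1)) (hneg : ∀ x < 0, f x = 0) {a b : ℕ → ℝ}
    (ha : ∀ n, 0 < a n) {α : ℝ} (hα : 0 < α)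
    (hconv : ∀ x, Tendsto (fun n : ℕ => f (a n * x + b n) ^ n) atTop (𝓝 (frechetCdf α x)))
    {c : ℝ} (hc0 : 0 < c) (hc1 : c < 1) : HasScaledLevels f c (c ^ α) := by
  intro τ hτ
  rcases hτ.eq_or_lt with rfl | hτ
  · rw [zero_mul]
    exact exists_levels_zero hf h1 htop hc0 hc1
  have hval : ∀ x > 0, frechetCdf α x = Real.exp (-x ^ (-α)) := fun x hx => if_pos hx
  have tail : ∀ x > 0,
      Tendsto (fun n : ℕ => (n : ℝ) * (1 - f (a n * x + b n))) atTop (𝓝 (x ^ (-α))) :=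
    fun x hx => tendsto_mul_one_sub_of_tendsto_pow (fun n => h0 _) (hval x hx ▸ hconv x)
  have nonneg : ∀ x > 0, ∀ᶠ n in atTop, 0 ≤ a n * x + b n := fun x hx =>
    eventually_nonneg_of_tendsto_pow hneg (by rw [hval x hx]; positivity) (hconv x)
  set x : ℝ := τ ^ (-1 / α) with hx
  have hx0 : 0 < x := by positivity
  have hxα : x ^ (-α) = τ := by
    rw [hx, ← Real.rpow_mul hτ.le, show -1 / α * -α = 1 by field_simp, Real.rpow_one]
  refine ⟨fun n => a n * x + b n, nonneg x hx0, hxα ▸ tail x hx0, ?_⟩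
  have hxc : τ * c ^ α = (x / c) ^ (-α) := by
    rw [Real.div_rpow hx0.le hc0.le, hxα, Real.rpow_neg hc0.le, div_inv_eq_mul]
  rw [hxc]
  have hc : 0 < 1 / c - 1 := by rw [sub_pos, lt_div_iff₀ hc0]; linarith
  -- `(a_n x + b_n) / c = a_n z_n + b_n` where `z_n = x / c + (b_n / a_n) (1 / c - 1) → x / c`
  have hsq : ∀ δ > 0, ∀ᶠ n in atTop, a n * (x / c - δ) + b n ≤ (a n * x + b n) / c ∧
      (a n * x + b n) / c ≤ a n * (x / c + δ) + b n := by
    intro δ hδ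
    have hη : 0 < δ / (1 / c - 1) := by positivity
    filter_upwards [nonneg _ hη, eventually_div_le_of_frechet hf ha hα tail hη] with n h3 h4
    rw [div_le_iff₀ (ha n)] at h4
    have h5 := mul_nonneg h3 hc.le
    have h6 := mul_le_mul_of_nonneg_right h4 hc.le
    have h7 : δ / (1 / c - 1) * (1 / c - 1) = δ := div_mul_cancel₀ _ hc.ne'
    have h8 : (a n * (δ / (1 / c - 1)) + b n) * (1 / c - 1) = a n * δ + b n * (1 / c - 1) := by
      rw [add_mul, mul_assoc, h7]
    have h9 : δ / (1 / c - 1) * a n * (1 / c - 1) = a n * δ := by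
      rw [mul_right_comm, h7, mul_comm]
    have h10 : (a n * x + b n) / c = a n * (x / c) + b n * (1 / c - 1) + b n := by ring
    rw [h10]
    constructor <;> nlinarith
  have hcont : ContinuousAt (fun y : ℝ => y ^ (-α)) (x / c) :=
    Real.continuousAt_rpow_const _ _ (Or.inl (by positivity))
  have hxc0 : 0 < x / c := by positivity
  refine tendsto_order.2 ⟨fun l hl => ?_, fun l hl => ?_⟩
  · obtain ⟨y, hy1, hy2⟩ := (((hcont.tendsto.mono_left
      (nhdsWithin_le_nhds (s := Set.Ioi (x / c)))).eventually_const_lt hl).and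
      (eventually_mem_nhdsWithin (s := Set.Ioi (x / c)))).exists
    rw [Set.mem_Ioi] at hy2
    filter_upwards [hsq (y - x / c) (by linarith), (tail y (by linarith)).eventually_const_lt hy1]
      with n h3 h4
    refine h4.trans_le ?_
    have := hf (h3.2.trans_eq (by rw [add_sub_cancel]))
    gcongr
  · obtain ⟨y, hy1, hy2, hy3⟩ := (((hcont.tendsto.mono_left
      (nhdsWithin_le_nhds (s := Set.Iio (x / c)))).eventually_lt_const hl).and
      ((eventually_mem_nhdsWithin (s := Set.Iio (x / c))).and
        (eventually_nhdsWithin_of_eventually_nhds (eventually_gt_nhds hxc0)))).exists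
    rw [Set.mem_Iio] at hy2
    filter_upwards [hsq (x / c - y) (by linarith), (tail y hy3).eventually_lt_const hy1] with n h3 h4
    refine lt_of_le_of_lt ?_ h4
    have := hf ((h3.1).trans_eq' (by rw [sub_sub_cancel]))
    gcongr

/-! ### The extreme value distribution functions are continuous -/

theorem continuous_gumbelCdf : Continuous gumbelCdf := by
  unfold gumbelCdf; fun_prop

theorem continuous_weibullCdf {α : ℝ} (hα : 0 < α) : Continuous (weibullCdf α) := by
  have h : weibullCdf α = fun x => Real.exp (-(max (-x) 0) ^ α) := by
    ext x
    unfold weibullCdf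
    split_ifs with hx
    · rw [max_eq_left (by linarith)]
    · rw [max_eq_right (by linarith), Real.zero_rpow hα.ne', neg_zero, Real.exp_zero]
  rw [h]
  exact (((continuous_neg.max continuous_const).rpow_const fun _ => Or.inr hα.le).neg).rexp

theorem continuous_frechetCdf {α : ℝ} (hα : 0 < α) : Continuous (frechetCdf α) := by
  have h : frechetCdf α = fun x => expNegInvGlue ((max x 0) ^ α) := by
    ext x
    unfold frechetCdf expNegInvGlue
    split_ifs with hx hx' hx'
    · exact absurd hx' (not_le.2 (Real.rpow_pos_of_pos (lt_max_of_lt_left hx) α))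
    · rw [max_eq_left hx.le, Real.rpow_neg hx.le]
    · rfl
    · rw [max_eq_right (not_lt.1 hx), Real.zero_rpow hα.ne'] at hx'
      exact absurd le_rfl hx'
  rw [h]
  exact (expNegInvGlue.contDiff (n := 0)).continuous.comp
    ((continuous_id.max continuous_const).rpow_const fun _ => Or.inr hα.le)

theorem gumbelCdf_pos (x : ℝ) : 0 < gumbelCdf x := Real.exp_pos _

theorem weibullCdf_pos (α x : ℝ) : 0 < weibullCdf α x := by
  unfold weibullCdf; split_ifs <;> positivity

theorem exists_cdf_eq_exp_neg {μ : Measure ℝ} (hμ : Continuous (cdf μ)) {t : ℝ} (ht : 0 < t) :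
    ∃ x, cdf μ x = Real.exp (-t) := by
  obtain ⟨x, hx⟩ := ((tendsto_cdf_atBot μ).eventually_lt_const (Real.exp_pos (-t))).exists
  obtain ⟨y, hy⟩ := ((tendsto_cdf_atTop μ).eventually_const_lt
    (show Real.exp (-t) < 1 from Real.exp_zero ▸ Real.exp_lt_exp.2 (by linarith))).exists
  exact mem_range_of_exists_le_of_exists_ge hμ ⟨x, hx.le⟩ ⟨y, hy.le⟩

/-! ### Distribution functions with extended arguments -/

/-- The distribution function of a law on `ℝ` with arguments in `[-∞, +∞]`. -/
noncomputable def cdfExt (μ : Measure ℝ) (x : EReal) : ℝ := μ.real {y : ℝ | (y : EReal) ≤ x}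

theorem measurableSet_coe_le (x : EReal) : MeasurableSet {y : ℝ | (y : EReal) ≤ x} :=
  measurableSet_le measurable_coe_real_ereal measurable_const

theorem cdfExt_coe (μ : Measure ℝ) [IsProbabilityMeasure μ] (x : ℝ) :
    cdfExt μ (x : EReal) = cdf μ x := by
  rw [cdf_eq_real, cdfExt]
  congr 1
  ext y
  simp

/-- `F(F⁻¹(q)) = q` for continuous `F`; for `q = 1` the value `F⁻¹(1) = +∞` is possible. -/
theorem cdfExt_genInverse {μ : Measure ℝ} [IsProbabilityMeasure μ] (hμ : Continuous (cdf μ))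
    {q : ℝ} (hq0 : 0 < q) (hq1 : q ≤ 1) : cdfExt μ (genInverse μ q) = q := by
  set S : Set ℝ := {y : ℝ | q ≤ cdf μ y} with hS
  rcases S.eq_empty_or_nonempty with he | hne
  · have hq : q = 1 := by
      refine hq1.antisymm (le_of_not_gt fun hlt => ?_)
      obtain ⟨y, hy⟩ := ((tendsto_cdf_atTop μ).eventually_const_lt hlt).exists
      exact Set.eq_empty_iff_forall_notMem.1 he y hy.le
    have hinv : genInverse μ q = ⊤ := by
      rw [genInverse, ← hS, he, Set.image_empty, sInf_empty]
    rw [hinv, hq, cdfExt]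
    simp
  · have hbdd : BddBelow S := by
      obtain ⟨x, hx⟩ := ((tendsto_cdf_atBot μ).eventually_lt_const hq0).exists
      refine ⟨x, fun y hy => le_of_not_gt fun hlt => ?_⟩
      exact absurd ((hy : q ≤ cdf μ y).trans (monotone_cdf μ hlt.le)) (not_le.2 hx)
    have hclosed : IsClosed S := isClosed_le continuous_const hμ
    have hmem : sInf S ∈ S := hclosed.csInf_mem hne hbdd
    have hleast : IsLeast S (sInf S) := ⟨hmem, fun y hy => csInf_le hbdd hy⟩
    have hinv : genInverse μ q = ((sInf S : ℝ) : EReal) :=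
      ((EReal.coe_strictMono.monotone.map_isLeast hleast).isGLB).sInf_eq
    rw [hinv, cdfExt_coe]
    refine le_antisymm ?_ hmem
    refine le_of_tendsto (hμ.continuousAt.tendsto.mono_left
      (nhdsWithin_le_nhds (s := Set.Iio (sInf S)))) ?_
    filter_upwards [self_mem_nhdsWithin] with y hy
    exact (not_le.1 fun hle => notMem_of_lt_csInf hy hbdd hle).le

/-- Probabilities of intersections are `ℓ¹`-Lipschitz in those of the intersected events, for
families that are nested index by index. -/
theorem abs_measureReal_iInter_sub_le {Ω ι : Type*} [Fintype ι] [MeasurableSpace Ω] (μ : Measure Ω)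
    [IsFiniteMeasure μ] {A B : ι → Set Ω} (hA : ∀ i, MeasurableSet (A i))
    (hB : ∀ i, MeasurableSet (B i)) (hAB : ∀ i, A i ⊆ B i ∨ B i ⊆ A i) :
    |μ.real (⋂ i, A i) - μ.real (⋂ i, B i)| ≤ ∑ i, |μ.real (A i) - μ.real (B i)| := by
  have key : ∀ {A B : ι → Set Ω}, (∀ i, MeasurableSet (A i)) → (∀ i, MeasurableSet (B i)) →
      (∀ i, A i ⊆ B i ∨ B i ⊆ A i) →
      μ.real (⋂ i, A i) ≤ μ.real (⋂ i, B i) + ∑ i, |μ.real (A i) - μ.real (B i)| := by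
    intro A B _ hB hAB
    have hsub : (⋂ i, A i) ⊆ (⋂ i, B i) ∪ ⋃ i, A i \ B i := by
      intro ω hω
      by_cases h : ω ∈ ⋂ i, B i
      · exact Or.inl h
      · obtain ⟨i, hi⟩ := not_forall.1 (mt Set.mem_iInter.2 h)
        exact Or.inr (Set.mem_iUnion.2 ⟨i, Set.mem_iInter.1 hω i, hi⟩)
    refine (measureReal_mono hsub).trans ((measureReal_union_le _ _).trans ?_)
    gcongr
    refine (measureReal_iUnion_fintype_le _).trans (Finset.sum_le_sum fun i _ => ?_)
    rcases hAB i with h | h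
    · rw [Set.sdiff_eq_empty.2 h, measureReal_empty]
      exact abs_nonneg _
    · rw [measureReal_sdiff h (hB i)]
      exact le_abs_self _
  have h1 := key hA hB hAB
  have h2 := key hB hA fun i => (hAB i).symm
  simp only [abs_sub_comm (μ.real (B _))] at h2
  rw [abs_le]
  constructor <;> linarith

section JointCdf

variable {ι : Type*}

theorem jointCdfExt_coe (μ : Measure (ι → ℝ)) (x : ι → ℝ) :
    jointCdfExt μ (fun i => (x i : EReal)) = jointCdf μ x := by
  rw [jointCdfExt, jointCdf]
  congr 1
  ext y
  simp [Pi.le_def]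

theorem isProbabilityMeasure_margin (μ : Measure (ι → ℝ)) [IsProbabilityMeasure μ] (j : ι) :
    IsProbabilityMeasure (margin μ j) :=
  Measure.isProbabilityMeasure_map (measurable_pi_apply j).aemeasurable

attribute [local instance] isProbabilityMeasure_margin

theorem cdfExt_margin (μ : Measure (ι → ℝ)) (j : ι) (x : EReal) :
    cdfExt (margin μ j) x = μ.real {y | (y j : EReal) ≤ x} :=
  map_measureReal_apply (measurable_pi_apply j) (measurableSet_coe_le x)

theorem cdf_margin (μ : Measure (ι → ℝ)) [IsProbabilityMeasure μ] (j : ι) (x : ℝ) :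
    cdf (margin μ j) x = μ.real {y | y j ≤ x} := by
  rw [cdf_eq_real, margin, map_measureReal_apply (measurable_pi_apply j) measurableSet_Iic]
  rfl

theorem measurableSet_coe_apply_le (i : ι) (x : EReal) :
    MeasurableSet {z : ι → ℝ | (z i : EReal) ≤ x} :=
  measurableSet_le (measurable_coe_real_ereal.comp (measurable_pi_apply i)) measurable_const

theorem jointCdf_nonneg (μ : Measure (ι → ℝ)) (x : ι → ℝ) : 0 ≤ jointCdf μ x := measureReal_nonneg

theorem jointCdf_le_one (μ : Measure (ι → ℝ)) [IsProbabilityMeasure μ] (x : ι → ℝ) :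
    jointCdf μ x ≤ 1 := measureReal_le_one

theorem jointCdf_mono (μ : Measure (ι → ℝ)) [IsFiniteMeasure μ] : Monotone (jointCdf μ) :=
  fun _ _ h => measureReal_mono (Set.Iic_subset_Iic.2 h)

theorem jointCdf_le_cdf_margin (μ : Measure (ι → ℝ)) [IsProbabilityMeasure μ] (x : ι → ℝ) (j : ι) :
    jointCdf μ x ≤ cdf (margin μ j) (x j) := by
  rw [cdf_margin]
  exact measureReal_mono fun y hy => hy j

variable [Fintype ι]

theorem abs_jointCdfExt_sub_le (μ : Measure (ι → ℝ)) [IsFiniteMeasure μ] (x y : ι → EReal) :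
    |jointCdfExt μ x - jointCdfExt μ y| ≤
      ∑ i, |cdfExt (margin μ i) (x i) - cdfExt (margin μ i) (y i)| := by
  simp only [cdfExt_margin, jointCdfExt, Set.ofPred_forall]
  refine abs_measureReal_iInter_sub_le μ (fun i => measurableSet_coe_apply_le i _)
    (fun i => measurableSet_coe_apply_le i _) fun i => ?_
  rcases le_total (x i) (y i) with h | h
  · exact Or.inl fun z hz => le_trans hz h
  · exact Or.inr fun z hz => le_trans hz h

theorem abs_jointCdf_sub_le (μ : Measure (ι → ℝ)) [IsProbabilityMeasure μ] (x y : ι → ℝ) :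
    |jointCdf μ x - jointCdf μ y| ≤ ∑ i, |cdf (margin μ i) (x i) - cdf (margin μ i) (y i)| := by
  have := abs_jointCdfExt_sub_le μ (fun i => (x i : EReal)) (fun i => (y i : EReal))
  simpa only [jointCdfExt_coe, cdfExt_coe] using this

theorem continuous_jointCdf {μ : Measure (ι → ℝ)} [IsProbabilityMeasure μ]
    (h : ∀ j, Continuous (cdf (margin μ j))) : Continuous (jointCdf μ) := by
  refine continuous_iff_continuousAt.2 fun x => tendsto_iff_dist_tendsto_zero.2 ?_
  refine squeeze_zero (fun _ => dist_nonneg) (fun y => abs_jointCdf_sub_le μ y x) ?_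
  have hc : Continuous fun y : ι → ℝ =>
      ∑ i, |cdf (margin μ i) (y i) - cdf (margin μ i) (x i)| :=
    continuous_finsetSum _ fun i _ =>
      (((h i).comp (continuous_apply i)).sub continuous_const).abs
  simpa using hc.tendsto x

theorem one_sub_jointCdf_le (μ : Measure (ι → ℝ)) [IsProbabilityMeasure μ] (x : ι → ℝ) :
    1 - jointCdf μ x ≤ ∑ i, (1 - cdf (margin μ i) (x i)) := by
  have h1 : jointCdfExt μ (fun _ => ⊤) = 1 := by simp [jointCdfExt]
  have h2 := abs_jointCdfExt_sub_le μ (fun _ => ⊤) (fun i => (x i : EReal))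
  have h3 : ∀ i, cdfExt (margin μ i) ⊤ = 1 := fun i => by simp [cdfExt]
  simp only [h1, jointCdfExt_coe, cdfExt_coe, h3] at h2
  refine (le_abs_self _).trans (h2.trans_eq (Finset.sum_congr rfl fun i _ => ?_))
  exact abs_of_nonneg (sub_nonneg.2 (cdf_le_one _ _))

/-- `P(ξ_j ≤ x_j) ≤ P(ξ ≤ x) + P(ξ ≰ y)` if `y` exceeds `x` off the coordinate `j`. -/
theorem cdf_margin_le (μ : Measure (ι → ℝ)) [IsProbabilityMeasure μ] {x y : ι → ℝ} {j : ι}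
    (h : ∀ i ≠ j, y i ≤ x i) :
    cdf (margin μ j) (x j) ≤ jointCdf μ x + (1 - jointCdf μ y) := by
  rw [cdf_margin, jointCdf, jointCdf, ← probReal_compl_eq_one_sub measurableSet_Iic]
  refine (measureReal_mono fun z hz => ?_).trans (measureReal_union_le _ _)
  by_cases hzy : z ≤ y
  · refine Or.inl fun i => ?_
    by_cases hi : i = j
    · exact hi ▸ hz
    · exact (hzy i).trans (h i hi)
  · exact Or.inr hzy

theorem tendsto_jointCdf_const (μ : Measure (ι → ℝ)) [IsProbabilityMeasure μ] :
    Tendsto (fun M : ℝ => jointCdf μ fun _ => M) atTop (𝓝 1) := by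
  have h1 : Tendsto (fun M : ℝ => ∑ i, (1 - cdf (margin μ i) M)) atTop (𝓝 0) := by
    have := tendsto_finsetSum (Finset.univ : Finset ι) fun i _ =>
      (tendsto_cdf_atTop (margin μ i)).const_sub 1
    simpa using this
  have h2 := squeeze_zero (fun M => sub_nonneg.2 (jointCdf_le_one μ fun _ => M))
    (fun M => one_sub_jointCdf_le μ fun _ => M) h1
  simpa using h2.const_sub 1

/-! ### Consequences of the max-domain condition -/

/-- The max-domain condition passes to the margins: the other coordinates get a large argument `M`,
and the probability that some normalized maximum exceeds `M` is controlled by `1 - H(M, …, M)`. -/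
theorem tendsto_cdf_margin_pow {F H : Measure (ι → ℝ)} [IsProbabilityMeasure F]
    [IsProbabilityMeasure H] {a b : ℕ → ι → ℝ} (ha : ∀ n j, 0 < a n j)
    (hconv : ∀ x : ι → ℝ, Tendsto (fun n : ℕ => jointCdf F (fun j => a n j * x j + b n j) ^ n) atTop
        (𝓝 (jointCdf H x))) (j : ι) (x : ℝ) :
    Tendsto (fun n : ℕ => cdf (margin F j) (a n j * x + b n j) ^ n) atTop
      (𝓝 (cdf (margin H j) x)) := by
  classical
  refine Metric.tendsto_nhds.2 fun ε hε => ?_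
  obtain ⟨M, hM, hxM⟩ := (((tendsto_jointCdf_const H).eventually_const_lt
    (show 1 - ε / 4 < 1 by linarith)).and (eventually_ge_atTop x)).exists
  set z : ι → ℝ := Function.update (fun _ => M) j x with hz
  have hzj : z j = x := Function.update_self _ _ _
  have hzi : ∀ i ≠ j, z i = M := fun i hi => Function.update_of_ne hi _ _
  have hzM : z ≤ fun _ => M := fun i => by
    by_cases hi : i = j
    · rw [hi, hzj]; exact hxM
    · exact (hzi i hi).le
  have hH1 : jointCdf H z ≤ cdf (margin H j) x := hzj ▸ jointCdf_le_cdf_margin H z j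
  have hH2 : cdf (margin H j) x ≤ jointCdf H z + (1 - jointCdf H fun _ => M) :=
    hzj ▸ cdf_margin_le H (j := j) fun i hi => (hzi i hi).ge
  filter_upwards [Metric.tendsto_nhds.1 (hconv z) (ε / 4) (by positivity),
    Metric.tendsto_nhds.1 (hconv fun _ => M) (ε / 4) (by positivity)] with n h1 h2
  rw [Real.dist_eq, abs_lt] at h1 h2 ⊢
  have hF1 := jointCdf_le_cdf_margin F (fun i => a n i * z i + b n i) j
  have hF2 := cdf_margin_le F (x := fun i => a n i * z i + b n i)
    (y := fun i => a n i * M + b n i) (j := j) fun i hi => by rw [hzi i hi]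
  have hF3 : jointCdf F (fun i => a n i * z i + b n i) ≤ jointCdf F fun i => a n i * M + b n i :=
    jointCdf_mono F fun i => by
      have := mul_le_mul_of_nonneg_left (hzM i) (ha n i).le
      dsimp only at this ⊢
      linarith
  simp only [hzj] at hF1 hF2
  have h3 := pow_le_pow_left₀ (jointCdf_nonneg F _) hF1 n
  have h4 := pow_le_pow_add_one_sub_pow (jointCdf_nonneg F _) hF1 hF3 (cdf_le_one _ _)
    (jointCdf_le_one F _) hF2 n
  constructor <;> linarith

theorem abs_exp_neg_sub_exp_neg_le {s t : ℝ} (hs : 0 ≤ s) (ht : 0 ≤ t) :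
    |Real.exp (-s) - Real.exp (-t)| ≤ |s - t| := by
  have key : ∀ {s t : ℝ}, 0 ≤ s → s ≤ t → |Real.exp (-s) - Real.exp (-t)| ≤ |s - t| := by
    intro s t hs hst
    rw [abs_of_nonneg (sub_nonneg.2 (Real.exp_le_exp.2 (neg_le_neg hst))), abs_sub_comm,
      abs_of_nonneg (sub_nonneg.2 hst)]
    have h1 : Real.exp (-t) = Real.exp (-s) * Real.exp (-(t - s)) := by
      rw [← Real.exp_add]; ring_nf
    have h2 : Real.exp (-s) ≤ 1 := Real.exp_le_one_iff.2 (by linarith)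
    have h3 := Real.add_one_le_exp (-(t - s))
    have h4 : Real.exp (-(t - s)) ≤ 1 := Real.exp_le_one_iff.2 (by linarith)
    rw [h1]
    nlinarith [Real.exp_pos (-s)]
  rcases le_total s t with h | h
  · exact key hs h
  · rw [abs_sub_comm, abs_sub_comm s]
    exact key ht h

/-- Whatever the levels, the limit of `F(u_n)^n` depends only on the limits `t_j` of the marginal
tails `n (1 - F_j(u_{n,j}))`. For `t_j > 0` the levels can be compared with `a_{n,j} x_j + b_{n,j}`,
and `t_j = 0` is approximated by small positive values. -/
theorem tendsto_jointCdf_pow {F H : Measure (ι → ℝ)} [IsProbabilityMeasure F]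
    [IsProbabilityMeasure H] {a b : ℕ → ι → ℝ} (ha : ∀ n j, 0 < a n j)
    (hconv : ∀ x : ι → ℝ, Tendsto (fun n : ℕ => jointCdf F (fun j => a n j * x j + b n j) ^ n) atTop
        (𝓝 (jointCdf H x))) (hcont : ∀ j, Continuous (cdf (margin H j)))
    {t : ι → ℝ} (ht : ∀ j, 0 ≤ t j) {u : ℕ → ι → ℝ}
    (hu : ∀ j, Tendsto (fun n : ℕ => (n : ℝ) * (1 - cdf (margin F j) (u n j))) atTop (𝓝 (t j))) :
    Tendsto (fun n : ℕ => jointCdf F (u n) ^ n) atTop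
      (𝓝 (copula H fun j => Real.exp (-t j))) := by
  refine Metric.tendsto_nhds.2 fun ε hε => ?_
  set N : ℝ := (Fintype.card ι : ℝ) with hN
  have hN0 : 0 ≤ N := Nat.cast_nonneg _
  set δ : ℝ := ε / (2 * N + 3) with hδ
  have hδ0 : 0 < δ := by positivity
  have hδε : δ * (2 * N + 3) = ε := div_mul_cancel₀ _ (by positivity)
  set s : ι → ℝ := fun j => max (t j) δ with hs
  have hs0 : ∀ j, 0 < s j := fun j => lt_max_of_lt_right hδ0
  have hst : ∀ j, |s j - t j| ≤ δ := fun j => by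
    rw [abs_of_nonneg (sub_nonneg.2 (le_max_left _ _)), sub_le_iff_le_add']
    exact max_le (by linarith) (by linarith [ht j])
  choose x hx using fun j => exists_cdf_eq_exp_neg (hcont j) (hs0 j)
  have hsum : ∑ j, |s j - t j| ≤ N * δ := by
    calc ∑ j, |s j - t j| ≤ ∑ _j : ι, δ := Finset.sum_le_sum fun j _ => hst j
      _ = N * δ := by simp [hN]
  have htail : ∀ j, Tendsto (fun n : ℕ => (n : ℝ) * (1 - cdf (margin F j) (a n j * x j + b n j)))
      atTop (𝓝 (s j)) := fun j =>
    tendsto_mul_one_sub_of_tendsto_pow (fun n => cdf_nonneg _ _)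
      (hx j ▸ tendsto_cdf_margin_pow ha hconv j (x j))
  have hH : |jointCdf H x - copula H fun j => Real.exp (-t j)| ≤ N * δ := by
    rw [← jointCdfExt_coe, copula]
    refine (abs_jointCdfExt_sub_le H _ _).trans (le_trans (Finset.sum_le_sum fun j _ => ?_) hsum)
    rw [cdfExt_coe, hx, cdfExt_genInverse (hcont j) (Real.exp_pos _)
      (Real.exp_le_one_iff.2 (neg_nonpos.2 (ht j)))]
    exact abs_exp_neg_sub_exp_neg_le (hs0 j).le (ht j)
  have hlim : Tendsto (fun n : ℕ => ∑ j, |(n : ℝ) * (1 - cdf (margin F j) (a n j * x j + b n j)) -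
      n * (1 - cdf (margin F j) (u n j))|) atTop (𝓝 (∑ j, |s j - t j|)) :=
    tendsto_finsetSum _ fun j _ => ((htail j).sub (hu j)).abs
  filter_upwards [hlim.eventually_lt_const (show _ < N * δ + δ by linarith),
    Metric.tendsto_nhds.1 (hconv x) δ hδ0] with n h1 h2
  have h3 : |jointCdf F (u n) ^ n - jointCdf F (fun j => a n j * x j + b n j) ^ n| ≤
      ∑ j, |(n : ℝ) * (1 - cdf (margin F j) (a n j * x j + b n j)) -
        n * (1 - cdf (margin F j) (u n j))| := by
    refine (abs_pow_sub_pow_le_mul (jointCdf_nonneg F _) (jointCdf_le_one F _)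
      (jointCdf_nonneg F _) (jointCdf_le_one F _) n).trans ?_
    refine (mul_le_mul_of_nonneg_left (abs_jointCdf_sub_le F _ _) n.cast_nonneg).trans_eq ?_
    rw [Finset.mul_sum]
    refine Finset.sum_congr rfl fun j _ => ?_
    rw [← mul_sub, abs_mul, Nat.abs_cast]
    congr 2
    ring
  rw [Real.dist_eq] at h2 ⊢
  have h4 := abs_sub_le (jointCdf F (u n) ^ n) (jointCdf F (fun j => a n j * x j + b n j) ^ n)
    (copula H fun j => Real.exp (-t j))
  have h5 := abs_sub_le (jointCdf F (fun j => a n j * x j + b n j) ^ n) (jointCdf H x)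
    (copula H fun j => Real.exp (-t j))
  linarith

/-- The limit of `F(u_n)^n` is positive when all marginal tails have finite limits. -/
theorem pos_of_tendsto_jointCdf_pow {F : Measure (ι → ℝ)} [IsProbabilityMeasure F] {t : ι → ℝ}
    {u : ℕ → ι → ℝ} {γ : ℝ}
    (hu : ∀ j, Tendsto (fun n : ℕ => (n : ℝ) * (1 - cdf (margin F j) (u n j))) atTop (𝓝 (t j)))
    (h : Tendsto (fun n : ℕ => jointCdf F (u n) ^ n) atTop (𝓝 γ)) : 0 < γ := by
  have h1 : Tendsto (fun n : ℕ => (n : ℝ) * (1 - (1 - ∑ j, (1 - cdf (margin F j) (u n j)))))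
      atTop (𝓝 (∑ j, t j)) := by
    refine (tendsto_finsetSum Finset.univ fun j _ => hu j).congr fun n => ?_
    rw [sub_sub_cancel, Finset.mul_sum]
  refine (Real.exp_pos _).trans_le
    (le_of_tendsto_of_tendsto (tendsto_pow_of_tendsto_mul_one_sub h1) h ?_)
  filter_upwards [(tendsto_one_of_tendsto_mul_one_sub h1).eventually_const_lt zero_lt_one] with n hn
  have := one_sub_jointCdf_le F (u n)
  exact pow_le_pow_left₀ hn.le (by linarith) n

/-- Coordinates with argument `1` can be dropped from a copula. -/
theorem copula_marginOn_eq {H : Measure (ι → ℝ)} [IsProbabilityMeasure H]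
    (hcont : ∀ j, Continuous (cdf (margin H j))) (I : Set ι) {v : ι → ℝ}
    (hv : ∀ j ∉ I, v j = 1) : copula (marginOn H I) (fun j => v j) = copula H v := by
  have hmap : Measurable fun (x : ι → ℝ) (i : I) => x i :=
    measurable_pi_lambda _ fun i => measurable_pi_apply _
  have hmargin : ∀ i : I, margin (marginOn H I) i = margin H i := fun i => by
    rw [margin, marginOn, Measure.map_map (measurable_pi_apply i) hmap]
    rfl
  have hmeas : MeasurableSet {y : I → ℝ | ∀ i, (y i : EReal) ≤ genInverse (margin H i) (v i)} := by
    rw [Set.ofPred_forall]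
    exact MeasurableSet.iInter fun i => measurableSet_coe_apply_le i _
  simp only [copula, jointCdfExt, hmargin]
  rw [marginOn, map_measureReal_apply hmap hmeas]
  refine measureReal_congr ?_
  have hae : ∀ j ∉ I, ∀ᵐ y ∂H, (y j : EReal) ≤ genInverse (margin H j) (v j) := by
    intro j hj
    have h1 := cdfExt_genInverse (hcont j) (hv j hj ▸ zero_lt_one) (hv j hj).le
    rw [cdfExt_margin, hv j hj] at h1
    rw [hv j hj]
    refine mem_ae_iff_prob_eq_one (measurableSet_coe_apply_le j _) |>.2 ?_
    exact (ENNReal.toReal_eq_one_iff _).1 h1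
  have hae' : ∀ᵐ y ∂H, ∀ j, j ∉ I → (y j : EReal) ≤ genInverse (margin H j) (v j) := by
    refine ae_all_iff.2 fun j => ?_
    by_cases hj : j ∈ I
    · exact Eventually.of_forall fun y h => absurd hj h
    · exact (hae j hj).mono fun y h _ => h
  filter_upwards [hae'] with y hy
  refine propext ⟨fun h j => ?_, fun h i => h i⟩
  by_cases hj : j ∈ I
  · exact h ⟨j, hj⟩
  · exact hy j hj

end JointCdf

/-! ### Maxima of a stationary ARMAX process -/

/-- The vectors bounded by `u` in the coordinates belonging to `J`. -/
def lowerBox {ι : Type*} (J : Set ι) (u : ι → ℝ) : Set (ι → ℝ) := {y | ∀ j ∈ J, y j ≤ u j}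

theorem measurableSet_lowerBox {ι : Type*} [Countable ι] (J : Set ι) (u : ι → ℝ) :
    MeasurableSet (lowerBox J u) := by
  simp only [lowerBox, Set.ofPred_forall]
  exact MeasurableSet.iInter fun j => MeasurableSet.iInter fun _ =>
    measurableSet_le (measurable_pi_apply j) measurable_const

namespace IsArmax

variable {d : ℕ} {Ω : Type*} [MeasurableSpace Ω] {P : Measure Ω}
  {c : Fin d → ℝ} {G : Measure (Fin d → ℝ)} {X Y : ℕ → Ω → Fin d → ℝ}

theorem measurable (hX : IsArmax P c G X Y) (n : ℕ) : Measurable (X n) := by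
  induction n with
  | zero => exact hX.measurable_init
  | succ n ih =>
    refine measurable_pi_lambda _ fun j => ?_
    simp only [hX.recursion (n + 1) (by omega), Nat.add_sub_cancel]
    exact (((measurable_pi_apply j).comp ih).const_mul _).max
      ((measurable_pi_apply j).comp (hX.measurable_innov (n + 1) (by omega)))

theorem prob_init_innov (hX : IsArmax P c G X Y) {S₀ : Set (Fin d → ℝ)} (hS₀ : MeasurableSet S₀)
    {S : ℕ → Set (Fin d → ℝ)} (hS : ∀ i, MeasurableSet (S i)) (n : ℕ) :
    P.real {ω | X 0 ω ∈ S₀ ∧ ∀ i ∈ Finset.Icc 1 n, Y i ω ∈ S i} =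
      P.real {ω | X 0 ω ∈ S₀} * ∏ i ∈ Finset.Icc 1 n, G.real (S i) := by
  have h := hX.indep.measure_inter_preimage_eq_mul (insert 0 (Finset.Icc 1 n))
    (sets := fun i => if i = 0 then S₀ else S i) fun i _ => by
      split_ifs; exacts [hS₀, hS i]
  rw [Finset.prod_insert (by simp), if_pos rfl, if_pos rfl] at h
  have hprod : ∏ i ∈ Finset.Icc 1 n, P ((if i = 0 then X 0 else Y i) ⁻¹' (if i = 0 then S₀ else S i))
      = ∏ i ∈ Finset.Icc 1 n, G (S i) := by
    refine Finset.prod_congr rfl fun i hi => ?_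
    have hi1 : 1 ≤ i := (Finset.mem_Icc.1 hi).1
    rw [if_neg (by omega), if_neg (by omega), ← hX.law_innov i hi1,
      Measure.map_apply (hX.measurable_innov i hi1) (hS i)]
  rw [hprod] at h
  have hset : {ω | X 0 ω ∈ S₀ ∧ ∀ i ∈ Finset.Icc 1 n, Y i ω ∈ S i} =
      ⋂ i ∈ insert 0 (Finset.Icc 1 n),
        (if i = 0 then X 0 else Y i) ⁻¹' (if i = 0 then S₀ else S i) := by
    ext ω
    simp only [Set.mem_iInter, Finset.forall_mem_insert, Set.mem_ofPred_eq, if_true,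
      Set.mem_preimage]
    refine and_congr_right fun _ => forall₂_congr fun i hi => ?_
    have hi1 : 1 ≤ i := (Finset.mem_Icc.1 hi).1
    rw [if_neg (by omega), if_neg (by omega)]
  simp only [measureReal_def]
  rw [hset, h, ENNReal.toReal_mul, ENNReal.toReal_prod]
  rfl

theorem mem_lowerBox_succ (hX : IsArmax P c G X Y) (J : Set (Fin d)) (u : Fin d → ℝ) (n : ℕ)
    (ω : Ω) : X (n + 1) ω ∈ lowerBox J u ↔
      X n ω ∈ lowerBox J (fun j => u j / c j) ∧ Y (n + 1) ω ∈ lowerBox J u := by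
  simp only [lowerBox, Set.mem_ofPred_eq, hX.recursion (n + 1) (by omega), Nat.add_sub_cancel,
    max_le_iff, le_div_iff₀ (hX.pos _), mul_comm (c _)]
  exact ⟨fun h => ⟨fun j hj => (h j hj).1, fun j hj => (h j hj).2⟩,
    fun h j hj => ⟨h.1 j hj, h.2 j hj⟩⟩

theorem prob_one (hX : IsArmax P c G X Y) (J : Set (Fin d)) (u : Fin d → ℝ) :
    P.real {ω | X 1 ω ∈ lowerBox J u} =
      P.real {ω | X 0 ω ∈ lowerBox J (fun j => u j / c j)} * G.real (lowerBox J u) := by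
  have h := hX.prob_init_innov (measurableSet_lowerBox J fun j => u j / c j)
    (fun _ => measurableSet_lowerBox J u) 1
  simpa [hX.mem_lowerBox_succ J u 0] using h

theorem prob_two (hX : IsArmax P c G X Y) (J : Set (Fin d)) (u : Fin d → ℝ) :
    P.real {ω | X 2 ω ∈ lowerBox J u} =
      P.real {ω | X 1 ω ∈ lowerBox J (fun j => u j / c j)} * G.real (lowerBox J u) := by
  have h := hX.prob_init_innov (measurableSet_lowerBox J fun j => u j / c j / c j)
    (S := fun i => if i = 1 then lowerBox J (fun j => u j / c j) else lowerBox J u)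
    (fun i => by split_ifs <;> exact measurableSet_lowerBox J _) 2
  have hset : {ω | X 2 ω ∈ lowerBox J u} =
      {ω | X 0 ω ∈ lowerBox J (fun j => u j / c j / c j) ∧ ∀ i ∈ Finset.Icc 1 2, Y i ω ∈
        if i = 1 then lowerBox J (fun j => u j / c j) else lowerBox J u} := by
    ext ω
    have h12 : Finset.Icc 1 2 = {1, 2} := rfl
    rw [Set.mem_ofPred_eq, hX.mem_lowerBox_succ J u 1, hX.mem_lowerBox_succ J _ 0]
    simp [h12, and_assoc]
  rw [hset, h, hX.prob_one]
  have h12 : Finset.Icc 1 2 = {1, 2} := rfl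
  rw [h12, Finset.prod_pair (by norm_num), if_pos rfl, if_neg (by norm_num), mul_assoc]

theorem map_two (hX : IsArmax P c G X Y) (hstat : IsStationary P X) :
    P.map (X 2) = P.map (X 1) := by
  have h := congrArg (Measure.map fun x : ℕ → Fin d → ℝ => x 0) (hstat 1)
  rwa [Measure.map_map (measurable_pi_apply 0) (measurable_pi_lambda _ fun n => hX.measurable _),
    Measure.map_map (measurable_pi_apply 0) (measurable_pi_lambda _ fun n => hX.measurable _)] at h

/-- The stationarity equation `F(u) = F(u / c) G(u)`, in the coordinates belonging to `J`. -/
theorem prob_eq_mul (hX : IsArmax P c G X Y) (hstat : IsStationary P X) (J : Set (Fin d))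
    (u : Fin d → ℝ) : P.real {ω | X 1 ω ∈ lowerBox J u} =
      P.real {ω | X 1 ω ∈ lowerBox J (fun j => u j / c j)} * G.real (lowerBox J u) := by
  have h := congrArg (fun μ => Measure.real μ (lowerBox J u)) (hX.map_two hstat)
  simp only [map_measureReal_apply (hX.measurable _) (measurableSet_lowerBox J u)] at h
  exact h.symm.trans (hX.prob_two J u)

/-- For levels `u ≥ 0`, the inequality `X_{n-1} ≤ u` entails `c X_{n-1} ≤ u`, so that only the
innovations matter after time `1`. -/
theorem prob_forall_mem (hX : IsArmax P c G X Y) (J : Set (Fin d)) {u : Fin d → ℝ}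
    (hu : ∀ j ∈ J, 0 ≤ u j) {n : ℕ} (hn : 1 ≤ n) :
    P.real {ω | ∀ i ∈ Finset.Icc 1 n, X i ω ∈ lowerBox J u} =
      P.real {ω | X 0 ω ∈ lowerBox J (fun j => u j / c j)} * G.real (lowerBox J u) ^ n := by
  have h := hX.prob_init_innov (measurableSet_lowerBox J fun j => u j / c j)
    (fun _ => measurableSet_lowerBox J u) n
  rw [Finset.prod_const, Nat.card_Icc, Nat.add_sub_cancel] at h
  rw [← h]
  congr 1
  ext ω
  have hsub : lowerBox J u ⊆ lowerBox J fun j => u j / c j := fun y hy j hj =>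
    (hy j hj).trans (by
      rw [le_div_iff₀ (hX.pos j)]
      exact mul_le_of_le_one_right (hu j hj) (hX.lt_one j).le)
  constructor
  · intro hω
    refine ⟨((hX.mem_lowerBox_succ J u 0 ω).1 (hω 1 (Finset.mem_Icc.2 ⟨le_rfl, hn⟩))).1, ?_⟩
    intro i hi
    obtain ⟨k, rfl⟩ := Nat.exists_eq_add_of_le' (Finset.mem_Icc.1 hi).1
    exact ((hX.mem_lowerBox_succ J u k ω).1 (hω _ hi)).2
  · rintro ⟨h0, hY⟩ i hi
    have key : ∀ k, k ≤ n → X k ω ∈ lowerBox J (fun j => u j / c j) := by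
      intro k
      induction k with
      | zero => exact fun _ => h0
      | succ k ih => exact fun hk => hsub ((hX.mem_lowerBox_succ J u k ω).2
          ⟨ih (by omega), hY _ (Finset.mem_Icc.2 ⟨by omega, hk⟩)⟩)
    obtain ⟨k, rfl⟩ := Nat.exists_eq_add_of_le' (Finset.mem_Icc.1 hi).1
    have := (Finset.mem_Icc.1 hi).2
    exact (hX.mem_lowerBox_succ J u k ω).2 ⟨key k (by omega), hY _ hi⟩

/-- The maximum behaves like `n` independent copies of `X₁`, corrected by the factor
`F(u_n / c)^n`, because `G(u) = F(u) / F(u / c)`. -/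
theorem tendsto_prob_forall_mem (hX : IsArmax P c G X Y) (hstat : IsStationary P X)
    (J : Set (Fin d)) {u : ℕ → Fin d → ℝ} (hu : ∀ᶠ n in atTop, ∀ j ∈ J, 0 ≤ u n j) {γ δ : ℝ}
    (hδ : 0 < δ)
    (h1 : Tendsto (fun n : ℕ => P.real {ω | X 1 ω ∈ lowerBox J (u n)} ^ n) atTop (𝓝 γ))
    (h2 : Tendsto (fun n : ℕ => P.real {ω | X 1 ω ∈ lowerBox J (fun j => u n j / c j)} ^ n) atTop
      (𝓝 δ))
    (h3 : Tendsto (fun n : ℕ => P.real {ω | X 1 ω ∈ lowerBox J (fun j => u n j / c j)}) atTop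
      (𝓝 1)) :
    Tendsto (fun n : ℕ => P.real {ω | ∀ i ∈ Finset.Icc 1 n, X i ω ∈ lowerBox J (u n)}) atTop
      (𝓝 (γ / δ)) := by
  have h4 := (h1.mul h3).div h2 hδ.ne'
  rw [mul_one] at h4
  refine h4.congr' ?_
  filter_upwards [hu, eventually_ge_atTop 1, h2.eventually_const_lt hδ] with n hn hn1 hpos
  simp only [Pi.div_apply]
  rw [hX.prob_forall_mem J hn hn1, div_eq_iff hpos.ne']
  obtain ⟨m, rfl⟩ := Nat.exists_eq_add_of_le' hn1
  have hA := hX.prob_one J (u (m + 1))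
  have hB := hX.prob_eq_mul hstat J (u (m + 1))
  generalize P.real {ω | X 1 ω ∈ lowerBox J (u (m + 1))} = p at *
  generalize P.real {ω | X 1 ω ∈ lowerBox J (fun j => u (m + 1) j / c j)} = q at *
  generalize P.real {ω | X 0 ω ∈ lowerBox J (fun j => u (m + 1) j / c j)} = r at *
  generalize G.real (lowerBox J (u (m + 1))) = g at *
  calc p ^ (m + 1) * q = p ^ m * p * q := by rw [pow_succ]
    _ = (q * g) ^ m * (r * g) * q := by rw [← hA, ← hB]
    _ = r * g ^ (m + 1) * q ^ (m + 1) := by ring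

theorem jointCdf_map (hX : IsArmax P c G X Y) (u : Fin d → ℝ) :
    jointCdf (P.map (X 1)) u = P.real {ω | X 1 ω ∈ lowerBox Set.univ u} := by
  rw [jointCdf, map_measureReal_apply (hX.measurable 1) measurableSet_Iic]
  congr 1
  ext ω
  simp [lowerBox, Pi.le_def]

variable [IsProbabilityMeasure P]

theorem isProbabilityMeasure_map (hX : IsArmax P c G X Y) (n : ℕ) :
    IsProbabilityMeasure (P.map (X n)) :=
  Measure.isProbabilityMeasure_map (hX.measurable n).aemeasurable

theorem cdf_margin_map (hX : IsArmax P c G X Y) (j : Fin d) (x : ℝ) :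
    cdf (margin (P.map (X 1)) j) x = P.real {ω | X 1 ω j ≤ x} := by
  have := hX.isProbabilityMeasure_map 1
  rw [cdf_margin, map_measureReal_apply (hX.measurable 1)
    (measurableSet_le (measurable_pi_apply j) measurable_const)]
  rfl

theorem cdf_margin_map_eq_lowerBox (hX : IsArmax P c G X Y) (j : Fin d) (u : Fin d → ℝ) :
    cdf (margin (P.map (X 1)) j) (u j) = P.real {ω | X 1 ω ∈ lowerBox {j} u} := by
  rw [hX.cdf_margin_map]
  simp [lowerBox]

theorem prob_lt (hX : IsArmax P c G X Y) (j : Fin d) (x : ℝ) :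
    P.real {ω | x < X 1 ω j} = 1 - cdf (margin (P.map (X 1)) j) x := by
  have hm : MeasurableSet {ω | X 1 ω j ≤ x} :=
    measurableSet_le ((measurable_pi_apply j).comp (hX.measurable 1)) measurable_const
  rw [hX.cdf_margin_map, ← probReal_compl_eq_one_sub hm]
  congr 1
  ext ω
  simp

/-- The margins of the stationary law live on `[0, ∞)`: for `x < 0` the stationarity equation
gives `F_j(x) ≤ F_j(x / c_j) ≤ F_j(x / c_j²) ≤ …`, with limit `F_j(-∞) = 0`. -/
theorem cdf_margin_map_of_neg (hX : IsArmax P c G X Y) (hstat : IsStationary P X) (j : Fin d)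
    {x : ℝ} (hx : x < 0) : cdf (margin (P.map (X 1)) j) x = 0 := by
  have hG : IsProbabilityMeasure G := by
    rw [← hX.law_innov 1 le_rfl]
    exact Measure.isProbabilityMeasure_map (hX.measurable_innov 1 le_rfl).aemeasurable
  have step : ∀ y, cdf (margin (P.map (X 1)) j) y ≤ cdf (margin (P.map (X 1)) j) (y / c j) := by
    intro y
    have h1 := hX.cdf_margin_map_eq_lowerBox j fun _ => y
    have h2 := hX.cdf_margin_map_eq_lowerBox j fun i => y / c i
    have h3 := hX.prob_eq_mul hstat {j} fun _ => y
    rw [h1, h2, h3]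
    exact mul_le_of_le_one_right measureReal_nonneg measureReal_le_one
  have iter : ∀ k : ℕ, cdf (margin (P.map (X 1)) j) x ≤
      cdf (margin (P.map (X 1)) j) (x * (1 / c j) ^ k) := by
    intro k
    induction k with
    | zero => simp
    | succ k ih =>
      refine ih.trans ((step _).trans_eq ?_)
      rw [pow_succ, ← mul_assoc, mul_one_div]
  have hlim : Tendsto (fun k : ℕ => x * (1 / c j) ^ k) atTop atBot :=
    (tendsto_pow_atTop_atTop_of_one_lt
      ((one_lt_div (hX.pos j)).2 (hX.lt_one j))).const_mul_atTop_of_neg hx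
  exact (ge_of_tendsto' ((tendsto_cdf_atBot _).comp hlim) iter).antisymm (cdf_nonneg _ _)

/-! ### Extremal indices from scaled levels -/

theorem hasExtremalIndex (hX : IsArmax P c G X Y) (hstat : IsStationary P X) {j : Fin d} {κ : ℝ}
    (hκ0 : 0 ≤ κ) (hκ1 : κ ≤ 1)
    (h : HasScaledLevels (cdf (margin (P.map (X 1)) j)) (c j) κ) :
    HasExtremalIndex P (fun n ω => X n ω j) (1 - κ) := by
  refine ⟨by linarith, by linarith, fun τ hτ => ?_⟩
  obtain ⟨u, hu0, hu1, hu2⟩ := h τ hτ.le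
  refine ⟨u, by simpa only [hX.prob_lt] using hu1, ?_⟩
  have e1 := fun n => hX.cdf_margin_map_eq_lowerBox j fun _ => u n
  have e2 := fun n => hX.cdf_margin_map_eq_lowerBox j fun i => u n / c i
  have h1 := tendsto_pow_of_tendsto_mul_one_sub hu1
  have h2 := tendsto_pow_of_tendsto_mul_one_sub hu2
  have h3 := tendsto_one_of_tendsto_mul_one_sub hu2
  simp only [e1, e2] at h1 h2 h3
  have h4 := hX.tendsto_prob_forall_mem hstat {j} (u := fun n _ => u n)
    (hu0.mono fun n hn _ _ => hn) (Real.exp_pos _) h1 h2 h3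
  rw [← Real.exp_sub] at h4
  have he : -((1 - κ) * τ) = -τ - -(τ * κ) := by ring
  rw [he]
  simpa [lowerBox] using h4

theorem hasMultivariateExtremalIndex (hX : IsArmax P c G X Y) (hstat : IsStationary P X)
    {H : Measure (Fin d → ℝ)} [IsProbabilityMeasure H] {a b : ℕ → Fin d → ℝ}
    (ha : ∀ n j, 0 < a n j)
    (hconv : ∀ x : Fin d → ℝ,
      Tendsto (fun n : ℕ => jointCdf (P.map (X 1)) (fun j => a n j * x j + b n j) ^ n) atTop
        (𝓝 (jointCdf H x))) (hcont : ∀ j, Continuous (cdf (margin H j)))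
    {κ : Fin d → ℝ} (hκ0 : ∀ j, 0 ≤ κ j)
    (h : ∀ j, HasScaledLevels (cdf (margin (P.map (X 1)) j)) (c j) (κ j)) :
    HasMultivariateExtremalIndex P X fun τ =>
      1 - Real.log (copula H fun j => Real.exp (-(τ j * κ j))) /
        Real.log (copula H fun j => Real.exp (-τ j)) := by
  have hF := hX.isProbabilityMeasure_map 1
  intro τ hτ hτ0
  choose u hu0 hu1 hu2 using fun j => h j (τ j) (hτ j)
  have hu0' : ∀ᶠ n in atTop, ∀ j, 0 ≤ u j n := eventually_all.2 hu0
  set γ : ℝ := copula H fun j => Real.exp (-τ j) with hγ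
  set δ : ℝ := copula H fun j => Real.exp (-(τ j * κ j)) with hδ
  have h1 : Tendsto (fun n : ℕ => jointCdf (P.map (X 1)) (fun j => u j n) ^ n) atTop (𝓝 γ) :=
    tendsto_jointCdf_pow ha hconv hcont hτ hu1
  have h2 : Tendsto (fun n : ℕ => jointCdf (P.map (X 1)) (fun j => u j n / c j) ^ n) atTop (𝓝 δ) :=
    tendsto_jointCdf_pow ha hconv hcont (fun j => mul_nonneg (hτ j) (hκ0 j)) hu2
  have h3 : Tendsto (fun n : ℕ => jointCdf (P.map (X 1)) (fun j => u j n / c j)) atTop (𝓝 1) := by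
    have hs : Tendsto (fun n : ℕ => ∑ j, (1 - cdf (margin (P.map (X 1)) j) (u j n / c j))) atTop
        (𝓝 0) := by
      simpa using tendsto_finsetSum Finset.univ fun j _ =>
        (tendsto_one_of_tendsto_mul_one_sub (hu2 j)).const_sub 1
    simpa using (squeeze_zero (fun n => sub_nonneg.2 (jointCdf_le_one _ _))
      (fun n => one_sub_jointCdf_le _ _) hs).const_sub 1
  have hγ0 : 0 < γ := pos_of_tendsto_jointCdf_pow hu1 h1
  have hδ0 : 0 < δ := pos_of_tendsto_jointCdf_pow hu2 h2
  have hδ1 : δ ≤ 1 := measureReal_le_one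
  have hγ1 : γ < 1 := by
    obtain ⟨j, hj⟩ := Function.ne_iff.1 hτ0
    have hjpos : 0 < τ j := (hτ j).lt_of_ne' hj
    calc γ ≤ cdfExt (margin H j) (genInverse (margin H j) (Real.exp (-τ j))) := by
          rw [cdfExt_margin]
          exact measureReal_mono fun y hy => hy j
      _ = Real.exp (-τ j) := by
          have := isProbabilityMeasure_margin H j
          exact cdfExt_genInverse (hcont j) (Real.exp_pos _)
            (Real.exp_le_one_iff.2 (neg_nonpos.2 (hτ j)))
      _ < 1 := Real.exp_lt_one_iff.2 (neg_neg_of_pos hjpos)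
  have hγδ : γ ≤ δ := by
    refine le_of_tendsto_of_tendsto h1 h2 ?_
    filter_upwards [hu0'] with n hn
    refine pow_le_pow_left₀ (jointCdf_nonneg _ _) (jointCdf_mono _ fun j => ?_) n
    rw [le_div_iff₀ (hX.pos j)]
    exact mul_le_of_le_one_right (hn j) (hX.lt_one j).le
  have hlogγ : Real.log γ < 0 := Real.log_neg hγ0 hγ1
  have hlogδ : Real.log δ ≤ 0 := Real.log_nonpos hδ0.le hδ1
  have hlog : Real.log γ ≤ Real.log δ := Real.log_le_log hγ0 hγδ
  have hq0 : 0 ≤ Real.log δ / Real.log γ := div_nonneg_of_nonpos hlogδ hlogγ.le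
  have hq1 : Real.log δ / Real.log γ ≤ 1 := (div_le_one_of_neg hlogγ).2 hlog
  refine ⟨by linarith, by linarith, fun n j => u j n, γ, hγ0, hγ1, ?_, ?_, ?_⟩
  · simpa only [hX.prob_lt] using hu1
  · simpa [hX.jointCdf_map, lowerBox] using h1
  · have hpow : γ ^ (1 - Real.log δ / Real.log γ) = γ / δ := by
      rw [Real.rpow_def_of_pos hγ0, mul_sub, mul_one, mul_div_cancel₀ _ hlogγ.ne, Real.exp_sub,
        Real.exp_log hγ0, Real.exp_log hδ0]
    rw [hpow]
    simp only [hX.jointCdf_map] at h1 h2 h3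
    simpa [lowerBox] using hX.tendsto_prob_forall_mem hstat Set.univ (u := fun n j => u j n)
      (hu0'.mono fun n hn j _ => hn j) hδ0 h1 h2 h3

end IsArmax

end MaxArmax

/-! ### The multivariate extremal index -/

open MaxArmax in
theorem mainTheorem1 {d : ℕ} {Ω : Type*} [MeasurableSpace Ω] (P : Measure Ω)
    [IsProbabilityMeasure P] (c α : Fin d → ℝ) (G F H : Measure (Fin d → ℝ))
    [IsProbabilityMeasure H] (X Y : ℕ → Ω → Fin d → ℝ)
    (hX : MaxArmax.IsArmax P c G X Y)
    (hstat : MaxArmax.IsStationary P X)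
    (hF : P.map (X 1) = F)
    (hα : ∀ j, 0 < α j)
    (hH : ∀ j, (cdf (MaxArmax.margin H j) : ℝ → ℝ) = MaxArmax.gumbelCdf ∨
      (cdf (MaxArmax.margin H j) : ℝ → ℝ) = MaxArmax.weibullCdf (α j) ∨
      (cdf (MaxArmax.margin H j) : ℝ → ℝ) = MaxArmax.frechetCdf (α j))
    (hFH : MaxArmax.InMaxDomain F H) :
    MaxArmax.HasMultivariateExtremalIndex P X (fun τ =>
      1 - Real.log (MaxArmax.copula (MaxArmax.marginOn H (MaxArmax.frechetIndices H α))
            (fun j => Real.exp (-(τ j * c j ^ α j)))) /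
          Real.log (MaxArmax.copula H (fun j => Real.exp (-τ j)))) ∧
    ∀ j,
      (((cdf (MaxArmax.margin H j) : ℝ → ℝ) = MaxArmax.gumbelCdf ∨
        (cdf (MaxArmax.margin H j) : ℝ → ℝ) = MaxArmax.weibullCdf (α j)) →
        MaxArmax.HasExtremalIndex P (fun n ω => X n ω j) 1) ∧
      ((cdf (MaxArmax.margin H j) : ℝ → ℝ) = MaxArmax.frechetCdf (α j) →
        MaxArmax.HasExtremalIndex P (fun n ω => X n ω j) (1 - c j ^ α j)) := by
  classical
  subst hF
  obtain ⟨a, b, ha, hconv⟩ := hFH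
  have := hX.isProbabilityMeasure_map 1
  have hcont : ∀ j, Continuous (cdf (margin H j)) := fun j => by
    rcases hH j with h | h | h
    · exact h ▸ continuous_gumbelCdf
    · exact h ▸ continuous_weibullCdf (hα j)
    · exact h ▸ continuous_frechetCdf (hα j)
  replace hconv := fun x => hconv x (continuous_jointCdf hcont).continuousAt
  have hconvj := tendsto_cdf_margin_pow ha hconv
  have hneg := fun j x (hx : x < 0) => hX.cdf_margin_map_of_neg hstat j hx
  have hlight : ∀ j, ((cdf (margin H j) : ℝ → ℝ) = gumbelCdf ∨
      (cdf (margin H j) : ℝ → ℝ) = weibullCdf (α j)) →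
      HasScaledLevels (cdf (margin (P.map (X 1)) j)) (c j) 0 := by
    intro j hj
    refine hasScaledLevels_zero (monotone_cdf _) (cdf_nonneg _) (cdf_le_one _)
      (tendsto_cdf_atTop _) (hneg j) (hconvj j) ?_
      (fun t ht => exists_cdf_eq_exp_neg (hcont j) ht) (hX.pos j) (hX.lt_one j)
    rcases hj with h | h <;> rw [h]
    · exact gumbelCdf_pos
    · exact weibullCdf_pos _
  have hheavy : ∀ j, (cdf (margin H j) : ℝ → ℝ) = frechetCdf (α j) →
      HasScaledLevels (cdf (margin (P.map (X 1)) j)) (c j) (c j ^ α j) := by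
    intro j hj
    refine hasScaledLevels_frechet (a := fun n => a n j) (b := fun n => b n j) (monotone_cdf _)
      (cdf_nonneg _) (cdf_le_one _) (tendsto_cdf_atTop _) (hneg j) (fun n => ha n j) (hα j)
      ?_ (hX.pos j) (hX.lt_one j)
    exact hj ▸ hconvj j
  have hpow0 : ∀ j, 0 ≤ c j ^ α j := fun j => Real.rpow_nonneg (hX.pos j).le _
  have hpow1 : ∀ j, c j ^ α j ≤ 1 := fun j =>
    Real.rpow_le_one (hX.pos j).le (hX.lt_one j).le (hα j).le
  refine ⟨?_, fun j => ⟨fun hj => ?_, fun hj => ?_⟩⟩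
  · set κ : Fin d → ℝ := fun j => if j ∈ frechetIndices H α then c j ^ α j else 0 with hκ
    have hκ0 : ∀ j, 0 ≤ κ j := fun j => by
      simp only [hκ]; split_ifs; exacts [hpow0 j, le_rfl]
    have hlev : ∀ j, HasScaledLevels (cdf (margin (P.map (X 1)) j)) (c j) (κ j) := fun j => by
      simp only [hκ]
      split_ifs with hj
      · exact hheavy j hj
      · exact hlight j ((hH j).imp_right fun h => h.resolve_right hj)
    have hmain := hX.hasMultivariateExtremalIndex hstat ha hconv hcont hκ0 hlev
    convert hmain using 5 with τ
    -- off the Fréchet indices the arguments of `C_H` are `e^0 = 1`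
    rw [← copula_marginOn_eq hcont (frechetIndices H α)
      fun j hj => by simp only [hκ, if_neg hj, mul_zero, neg_zero, Real.exp_zero]]
    congr 1
    ext j
    simp only [hκ, if_pos j.2]
  · simpa using hX.hasExtremalIndex hstat le_rfl zero_le_one (hlight j hj)
  · exact hX.hasExtremalIndex hstat (hpow0 j) (hpow1 j) (hheavy j hj)
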